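/- Let $X$ be a finite set of items. A \emph{valuation} is a function $v:2^X\to\mathbb{R}_{\ge 0}$ with $v(\emptyset)=0$ and $v(A)\le v(B)$ whenever $A\subseteq B$. For item prices $p\in\mathbb{R}^X$ let $D(v\mid p)$ be the family of all $S\subseteq X$ that maximize $v(S)-\sum_{x\in S}p_x$. A valuation $v$ satisfies \emph{gross substitutes} if, for every item $x$ and all price vectors $p\le q$ (coordinatewise) with $p_x=q_x$: if $x\in A$ for some $A\in D(v\mid p)$, then $x\in A'$ for some $A'\in D(v\mid q)$. In a VCG combinatorial auction finitely many bidders $j\in J$ submit valuations $b_j$ as bids. The items are allocated by a partition $(S_j)_{j\in J}$ of $X$ (bundles may be empty) that maximizes $\sum_{j} b_j(S_j)$ among all such partitions, with ties broken arbitrarily. Bidder $j$ pays $u_{-j}(X)-u_{-j}(X\setminus S_j)$, where $u_{-j}$ is the combined (OR) valuation of the bids of the others: $u_{-j}(S)$ is the maximum of $\sum_{k\ne j} b_k(T_k)$ over all pairwise disjoint families of sets $T_k\subseteq S$ $(k\in J,\ k\neq j)$, and it is $0$ if there are no other bidders. \textbf{Corollary.} Suppose that finitely many players $j$ have valuations $v_j$,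 all satisfying gross substitutes. Then no player $i$ can benefit from placing false-name bids. That is, let $(A_j)$ be any optimal allocation of the auction in which every player $j$ bids $v_j$, and let $\pi_i$ be the VCG payment of $i$ in it. Suppose that player $i$ instead participates under any finite number $k$ of identities with arbitrary valuations $w_1,\dots,w_k$ as bids, while every other player $j$ still bids $v_j$. Let these identities be allocated $S_1,\dots,S_k$ in any optimal allocation for these bids, and let their VCG payments be $\rho_1,\dots,\rho_k$. Then $$v_i(S_1\cup\dots\cup S_k)-\sum_{l=1}^k\rho_l\;\le\; v_i(A_i)-\pi_i .$$ -/

import Mathlib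

noncomputable section

namespace VCG

/-- A valuation on a set `X` of items: a normalized, monotone set function. -/
@[ext]
structure Valuation (X : Type*) where
  toFun : Finset X → ℝ
  map_empty' : toFun ∅ = 0
  mono' : ∀ A B : Finset X, A ⊆ B → toFun A ≤ toFun B

instance {X : Type*} : CoeFun (Valuation X) (fun _ => Finset X → ℝ) := ⟨Valuation.toFun⟩

/-- Valuations take values in the non-negative reals. -/
theorem Valuation.nonneg {X : Type*} (v : Valuation X) (A : Finset X) : 0 ≤ v A := by
  have h := v.mono' ∅ A (Finset.empty_subset A)
  rw [v.map_empty'] at h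
  exact h

/-- The surplus of the bundle `S` at item prices `p`. -/
def Valuation.surplus {X : Type*} (v : Valuation X) (p : X → ℝ) (S : Finset X) : ℝ :=
  v S - ∑ x ∈ S, p x

/-- The demand set of `v` at prices `p`: all bundles of maximal surplus. -/
def Valuation.demand {X : Type*} (v : Valuation X) (p : X → ℝ) : Set (Finset X) :=
  {S | ∀ T : Finset X, v.surplus p T ≤ v.surplus p S}

/-- The gross substitutes property. -/
def Valuation.GrossSubstitutes {X : Type*} (v : Valuation X) : Prop :=
  ∀ (x : X) (p q : X → ℝ), p ≤ q → p x = q x →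
    ∀ A ∈ v.demand p, x ∈ A → ∃ B ∈ v.demand q, x ∈ B

/-- Assignments of pairwise disjoint bundles of items of `S` to the agents in `ι`. Items of `S` may
remain unassigned; as valuations are monotone, this does not affect the optimal value, and it
makes the notion meaningful when there are no agents. -/
def Packing {X : Type*} (ι : Type*) (S : Finset X) : Type _ :=
  {A : ι → Finset X // (Pairwise fun j k => Disjoint (A j) (A k)) ∧ ∀ j, A j ⊆ S}

instance {X ι : Type*} (S : Finset X) : Nonempty (Packing ι S) :=
  ⟨⟨fun _ => ∅, fun _ _ _ => Finset.disjoint_empty_left _, fun _ => Finset.empty_subset _⟩⟩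

instance {X ι : Type*} [Finite X] [Finite ι] (S : Finset X) : Finite (Packing ι S) :=
  inferInstanceAs (Finite {A : ι → Finset X //
    (Pairwise fun j k => Disjoint (A j) (A k)) ∧ ∀ j, A j ⊆ S})

/-- The combined valuation (the OR) of finitely many valuations: its value on `S` is the largest
total value obtained by distributing the items of `S` among the agents. The OR of no valuations
is the zero valuation. -/
def combined {X ι : Type*} [Fintype X] [Fintype ι] (v : ι → Valuation X) : Valuation X where
  toFun S := ⨆ A : Packing ι S, ∑ j, v j (A.1 j)
  map_empty' := by
    have h : ∀ A : Packing ι (∅ : Finset X), ∑ j, v j (A.1 j) = 0 := fun A =>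
      Finset.sum_eq_zero fun j _ => by
        rw [Finset.subset_empty.mp (A.2.2 j), (v j).map_empty']
    simp only [h, ciSup_const]
  mono' := fun S T hST => ciSup_le fun A =>
    le_ciSup (f := fun A : Packing ι T => ∑ j, v j (A.1 j)) (Set.finite_range _).bddAbove
      ⟨A.1, A.2.1, fun j => (A.2.2 j).trans hST⟩

/-- An allocation: a partition of all the items into (possibly empty) bundles `A j`, one for each
bidder `j`. -/
def IsAllocation {X ι : Type*} (A : ι → Finset X) : Prop :=
  (Pairwise fun j k => Disjoint (A j) (A k)) ∧ ∀ x, ∃ j, x ∈ A j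

/-- An allocation that maximizes the total value with respect to the bids `b`. -/
def IsOptimalAllocation {X ι : Type*} [Fintype ι] (b : ι → Valuation X) (A : ι → Finset X) :
    Prop :=
  IsAllocation A ∧ ∀ B : ι → Finset X, IsAllocation B → ∑ j, b j (B j) ≤ ∑ j, b j (A j)

/-- The VCG payment of bidder `j` when the bids are `b` and `j` is allocated the bundle `S`:
`u(X) - u(X - S)`, where `u` is the combined valuation of the bids of all other bidders. -/
def payment {X ι : Type*} [Fintype X] [DecidableEq X] [Fintype ι] [DecidableEq ι]
    (b : ι → Valuation X) (j : ι) (S : Finset X) : ℝ :=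
  combined (fun k : {k : ι // k ≠ j} => b k) Finset.univ
    - combined (fun k : {k : ι // k ≠ j} => b k) (Finset.univ \ S)

/-- The bids in the auction in which player `i` is replaced by identities (false names) indexed by
`κ`, bidding `w`, while every other player `j` bids `v j`. -/
def falseNameBids {X ι κ : Type*} (v : ι → Valuation X) (i : ι) (w : κ → Valuation X) :
    {j : ι // j ≠ i} ⊕ κ → Valuation X :=
  Sum.elim (fun j => v j) w

end VCG

end

/-! Let `u` be the combined valuation of the other players, `S_l` the bundles of the identities, `S`
their union and `R` its complement. In the payment of identity `l` the other identities' bids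
cancel, leaving at least `u (R ∪ S_l) - u R`. If `u` is submodular, these marginals add up to at
least `u X - u R`. False names thus yield at most `v i S + u R - u X`, which is at most the optimal
welfare minus `u X`, the truthful utility.

Submodularity of `u` is where gross substitutes enters, through duality. The indirect utility of
each bidder is submodular in prices, and `u S` is the infimum over `p ≥ 0` of the summed indirect
utilities plus the price of `S`. Near-optimal prices `p` for `S` and `q` for `T` give `p ⊓ q` as a
test price for `S ∪ T` and `p ⊔ q` for `S ∩ T`. The infimum formula rests on an ascending auction
with increment `ε`; the error vanishes as `ε → 0`. -/

namespace VCG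

section Helpers

variable {X ι : Type*}

/-! ### Indirect utility and its submodularity in prices -/

/-- The indirect utility of `v` at prices `p`: the maximal surplus of a bundle. -/
noncomputable def Valuation.indirectUtility [Finite X] (v : Valuation X) (p : X → ℝ) : ℝ :=
  ⨆ S : Finset X, v.surplus p S

theorem Valuation.surplus_le_indirectUtility [Finite X] (v : Valuation X) (p : X → ℝ)
    (S : Finset X) : v.surplus p S ≤ v.indirectUtility p :=
  le_ciSup (f := fun S : Finset X => v.surplus p S) (Set.finite_range _).bddAbove S

theorem Valuation.indirectUtility_eq_of_mem_demand [Finite X] {v : Valuation X} {p : X → ℝ}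
    {S : Finset X} (h : S ∈ v.demand p) : v.indirectUtility p = v.surplus p S :=
  le_antisymm (ciSup_le h) (v.surplus_le_indirectUtility p S)

theorem Valuation.exists_mem_demand [Finite X] (v : Valuation X) (p : X → ℝ) :
    ∃ S, S ∈ v.demand p :=
  Finite.exists_max fun S : Finset X => v.surplus p S

theorem Valuation.surplus_add_single [DecidableEq X] (v : Valuation X) (p : X → ℝ) (x : X) (t : ℝ)
    (S : Finset X) :
    v.surplus (p + Pi.single x t) S = v.surplus p S - if x ∈ S then t else 0 := by
  have h : ∑ y ∈ S, (Pi.single x t : X → ℝ) y = if x ∈ S then t else 0 :=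
    Finset.sum_pi_single' x t S
  simp only [Valuation.surplus, Pi.add_apply, Finset.sum_add_distrib, h]
  ring

/-- Along one coordinate, the indirect utility is a maximum of a linear and a constant function,
where the break point is the largest price increase at which the item is still demanded. -/
theorem Valuation.exists_indirectUtility_add_single [Finite X] [DecidableEq X] (v : Valuation X)
    (p : X → ℝ) (x : X) :
    ∃ α β : ℝ, (∀ t, v.indirectUtility (p + Pi.single x t) = max (α - t) β) ∧
      ∀ t, (∃ S ∈ v.demand (p + Pi.single x t), x ∈ S) ↔ β ≤ α - t := by
  have : Nonempty {S : Finset X // x ∈ S} := ⟨⟨{x}, by simp⟩⟩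
  have : Nonempty {S : Finset X // x ∉ S} := ⟨⟨∅, by simp⟩⟩
  obtain ⟨⟨A, hxA⟩, hA⟩ := Finite.exists_max fun S : {S : Finset X // x ∈ S} => v.surplus p S
  obtain ⟨⟨B, hxB⟩, hB⟩ := Finite.exists_max fun S : {S : Finset X // x ∉ S} => v.surplus p S
  have hA' : ∀ S, x ∈ S → v.surplus p S ≤ v.surplus p A := fun S hS => hA ⟨S, hS⟩
  have hB' : ∀ S, x ∉ S → v.surplus p S ≤ v.surplus p B := fun S hS => hB ⟨S, hS⟩
  refine ⟨v.surplus p A, v.surplus p B, fun t => le_antisymm (ciSup_le fun S => ?_)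
    (max_le ?_ ?_), fun t => ⟨?_, fun h => ⟨A, fun S => ?_, hxA⟩⟩⟩
  · rw [surplus_add_single]
    split_ifs with hS
    · exact le_max_of_le_left (by linarith [hA' S hS])
    · exact le_max_of_le_right (by linarith [hB' S hS])
  · have h := v.surplus_le_indirectUtility (p + Pi.single x t) A
    rwa [surplus_add_single, if_pos hxA] at h
  · have h := v.surplus_le_indirectUtility (p + Pi.single x t) B
    rwa [surplus_add_single, if_neg hxB, sub_zero] at h
  · rintro ⟨S, hS, hxS⟩
    have h := hS B
    simp only [surplus_add_single, hxB, hxS, if_true, if_false] at h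
    linarith [hA' S hxS]
  · simp only [surplus_add_single, hxA, if_true]
    split_ifs with hS
    · linarith [hA' S hS]
    · linarith [hB' S hS]

/-- Gross substitutes says that the break point for `x` can only grow when other prices rise, and
the loss from raising the price of `x` is monotone in the break point. -/
theorem Valuation.GrossSubstitutes.indirectUtility_single [Finite X] [DecidableEq X]
    {v : Valuation X} (hv : v.GrossSubstitutes) {p q : X → ℝ} (hpq : p ≤ q) {x : X}
    (hx : p x = q x) {t : ℝ} (ht : 0 ≤ t) :
    v.indirectUtility p - v.indirectUtility (p + Pi.single x t) ≤
      v.indirectUtility q - v.indirectUtility (q + Pi.single x t) := by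
  obtain ⟨α, β, hp, hpx⟩ := v.exists_indirectUtility_add_single p x
  obtain ⟨γ, δ, hq, hqx⟩ := v.exists_indirectUtility_add_single q x
  -- At the increase `α - β` the bundles with and without `x` tie at `p`, so `x` is still demanded,
  -- hence also at `q`.
  have key : δ ≤ γ - (α - β) := by
    obtain ⟨S, hS, hxS⟩ := (hpx (α - β)).2 (by linarith)
    exact (hqx _).1 (hv x _ _ (add_le_add_left hpq _) (by simp [hx]) S hS hxS)
  have hp0 := hp 0
  have hq0 := hq 0
  simp only [Pi.single_zero, add_zero, sub_zero] at hp0 hq0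
  rw [hp0, hq0, hp, hq]
  rcases max_cases α β with h₁ | h₁ <;> rcases max_cases (α - t) β with h₂ | h₂ <;>
    rcases max_cases γ δ with h₃ | h₃ <;> rcases max_cases (γ - t) δ with h₄ | h₄ <;> linarith

/-- The one-coordinate losses telescope: raising one price at a time keeps `p ≤ q` and their
agreement on `s`. -/
theorem Valuation.GrossSubstitutes.indirectUtility_add [Finite X] [DecidableEq X]
    {v : Valuation X} (hv : v.GrossSubstitutes) {p q : X → ℝ} (hpq : p ≤ q) {d : X → ℝ}
    (hd : 0 ≤ d) (s : Finset X) (hs : ∀ x ∈ s, p x = q x) :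
    v.indirectUtility p - v.indirectUtility (p + ∑ x ∈ s, Pi.single x (d x)) ≤
      v.indirectUtility q - v.indirectUtility (q + ∑ x ∈ s, Pi.single x (d x)) := by
  induction s using Finset.induction_on with
  | empty => simp
  | insert a s ha ih =>
    have h₁ := ih fun x hx => hs x (Finset.mem_insert_of_mem hx)
    have h₂ := hv.indirectUtility_single (x := a)
      (add_le_add_left hpq (∑ x ∈ s, Pi.single x (d x)))
      (by simp [hs a (Finset.mem_insert_self a s)]) (hd a)
    rw [Finset.sum_insert ha, add_comm _ (∑ x ∈ s, _), ← add_assoc, ← add_assoc]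
    linarith

/-- The indirect utility of a gross substitutes valuation is submodular in the prices. -/
theorem Valuation.GrossSubstitutes.indirectUtility_submodular [Fintype X]
    {v : Valuation X} (hv : v.GrossSubstitutes) (p q : X → ℝ) :
    v.indirectUtility (p ⊓ q) + v.indirectUtility (p ⊔ q) ≤
      v.indirectUtility p + v.indirectUtility q := by
  classical
  -- Moving from `p ⊓ q` to `p` changes only prices where `q x ≤ p x`, and there `p ⊓ q` agrees with
  -- `q`.
  have hd : (0 : X → ℝ) ≤ p - p ⊓ q := sub_nonneg.2 inf_le_left
  have h := hv.indirectUtility_add (inf_le_right : p ⊓ q ≤ q) hd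
    (Finset.univ.filter fun x => q x ≤ p x) (by simp)
  have hsum : ∑ x ∈ Finset.univ.filter (fun x => q x ≤ p x),
      Pi.single x ((p - p ⊓ q) x) = p - p ⊓ q := by
    ext y
    rw [Finset.sum_apply, Finset.sum_pi_single]
    split_ifs with hy
    · rfl
    · have hy' : p y ≤ q y := by
        simp only [Finset.mem_filter, Finset.mem_univ, true_and, not_le] at hy
        exact hy.le
      simp [hy']
  have hsup : q + (p - p ⊓ q) = p ⊔ q := by
    ext x
    have := inf_add_sup (p x) (q x)
    simp only [Pi.add_apply, Pi.sub_apply, Pi.inf_apply, Pi.sup_apply]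
    linarith
  rw [hsum, hsup, add_sub_cancel] at h
  linarith

/-! ### The ascending auction -/

/-- Under gross substitutes, the items of a demanded bundle whose prices stay fixed while other
prices increase remain demanded together. -/
theorem Valuation.GrossSubstitutes.exists_superset_mem_demand [Fintype X]
    {v : Valuation X} (hv : v.GrossSubstitutes) {p q : X → ℝ} (hpq : p ≤ q) {A C : Finset X}
    (hA : A ∈ v.demand p) (hCA : C ⊆ A) (hC : ∀ x ∈ C, p x = q x) :
    ∃ B ∈ v.demand q, C ⊆ B := by
  classical
  have hsur : ∀ (r : X → ℝ) (S : Finset X),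
      v.surplus (r - fun x => if x ∈ C then 1 else 0) S
        = v.surplus r S + ((S ∩ C).card : ℝ) := by
    intro r S
    simp [Valuation.surplus, Finset.sum_sub_distrib, Finset.sum_ite_mem]
    ring
  -- A unit discount on `C` gains the full `C.card` at `p`. By submodularity it gains at least as
  -- much at `q`, which forces a bundle demanded at `q - e` to contain `C` and to be optimal at `q`.
  set e : X → ℝ := fun x => if x ∈ C then 1 else 0 with he
  have hsub := hv.indirectUtility_submodular p (q - e)
  have hinf : p ⊓ (q - e) = p - e := by
    ext x
    by_cases hx : x ∈ C
    · simp [he, hx, hC x hx]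
    · simpa [he, hx] using hpq x
  have hsup : p ⊔ (q - e) = q := by
    ext x
    by_cases hx : x ∈ C
    · simp [he, hx, hC x hx]
    · simpa [he, hx] using hpq x
  rw [hinf, hsup, Valuation.indirectUtility_eq_of_mem_demand hA] at hsub
  have hpe := v.surplus_le_indirectUtility (p - e) A
  rw [hsur, Finset.inter_eq_right.2 hCA] at hpe
  obtain ⟨B, hB⟩ := v.exists_mem_demand (q - e)
  rw [Valuation.indirectUtility_eq_of_mem_demand hB, hsur] at hsub
  have hBq := v.surplus_le_indirectUtility q B
  have hle : ((B ∩ C).card : ℝ) ≤ C.card :=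
    Nat.cast_le.2 (Finset.card_le_card Finset.inter_subset_right)
  refine ⟨B, fun T => ?_, ?_⟩
  · linarith [v.surplus_le_indirectUtility q T]
  · have hcard : C.card ≤ (B ∩ C).card := by
      have : (C.card : ℝ) ≤ (B ∩ C).card := by linarith
      exact_mod_cast this
    exact Finset.inter_eq_right.1 (Finset.eq_of_subset_of_card_le Finset.inter_subset_right hcard)

theorem Valuation.price_le_of_mem_demand [Fintype X] {v : Valuation X} {p : X → ℝ}
    {D : Finset X} (hD : D ∈ v.demand p) {x : X} (hx : x ∈ D) : p x ≤ v Finset.univ := by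
  classical
  have h := hD (D.erase x)
  have h₁ := Finset.add_sum_erase D p hx
  have h₂ := v.nonneg (D.erase x)
  have h₃ := v.mono' D Finset.univ (Finset.subset_univ D)
  simp only [Valuation.surplus] at h
  linarith

/-- The ascending auction: for gross substitutes valuations, prices starting at `r` can be
increased to prices `p` at which a disjoint family of bundles `S j` is demanded, where every
bidder `j` faces a surcharge `ε` on the items outside `S j`, and where the price of every
unassigned item is still the initial one. -/
theorem exists_approximate_equilibrium [Fintype X] [DecidableEq X] [Fintype ι]
    {v : ι → Valuation X} (hv : ∀ j, (v j).GrossSubstitutes) (r : X → ℝ) {ε : ℝ} (hε : 0 < ε) :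
    ∃ (p : X → ℝ) (S : ι → Finset X), r ≤ p ∧ (Pairwise fun j k => Disjoint (S j) (S k)) ∧
      (∀ x, (∀ j, x ∉ S j) → p x = r x) ∧
      ∀ j, S j ∈ (v j).demand fun x => p x + if x ∈ S j then 0 else ε := by
  classical
  let price : (X → ℕ) → X → ℝ := fun n x => r x + n x * ε
  -- Each `S j` need only lie inside a demanded bundle, since gross substitutes preserves no more
  -- than this. Equality comes from maximality of the total price.
  let valid : (X → ℕ) → (ι → Finset X) → Prop := fun n S =>
    (Pairwise fun j k => Disjoint (S j) (S k)) ∧ (∀ x, (∀ j, x ∉ S j) → n x = 0) ∧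
      ∀ j, ∃ D ∈ (v j).demand (fun x => price n x + if x ∈ S j then 0 else ε), S j ⊆ D
  obtain ⟨M, hM⟩ : ∃ M : ℕ, ∀ n S, valid n S → ∀ x, n x ≤ M := by
    have hb : ∀ x, ∃ m : ℕ, (∑ j, v j Finset.univ) - r x ≤ m * ε := fun x => by
      obtain ⟨m, hm⟩ := exists_nat_ge (((∑ j, v j Finset.univ) - r x) / ε)
      exact ⟨m, (div_le_iff₀ hε).1 hm⟩
    choose m hm using hb
    refine ⟨∑ x, m x, fun n S ⟨_, h₂, h₃⟩ x => ?_⟩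
    by_cases hx : ∀ j, x ∉ S j
    · simp [h₂ x hx]
    · push Not at hx
      obtain ⟨j, hj⟩ := hx
      obtain ⟨D, hD, hSD⟩ := h₃ j
      have h := Valuation.price_le_of_mem_demand hD (hSD hj)
      have h' : v j Finset.univ ≤ ∑ j, v j Finset.univ :=
        Finset.single_le_sum (f := fun j => v j Finset.univ)
          (fun j _ => (v j).nonneg _) (Finset.mem_univ j)
      have h'' : (n x : ℝ) * ε ≤ m x * ε := by
        simp only [price, hj, if_true] at h
        linarith [hm x]
      have h4 : n x ≤ m x := by exact_mod_cast le_of_mul_le_mul_right h'' hε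
      exact h4.trans (Finset.single_le_sum (f := m) (fun _ _ => Nat.zero_le _)
        (Finset.mem_univ x))
  obtain ⟨n, ⟨S, hS⟩, hmax⟩ : ∃ n, (∃ S, valid n S) ∧
      ∀ n', (∃ S, valid n' S) → ∑ x, n' x ≤ ∑ x, n x := by
    have hfin : {n | ∃ S, valid n S}.Finite :=
      (Set.finite_Iic fun _ : X => M).subset fun n ⟨S, hS⟩ x => hM n S hS x
    have hne : {n | ∃ S, valid n S}.Nonempty :=
      ⟨0, fun _ => ∅, fun _ _ _ => Finset.disjoint_empty_left _, fun _ _ => rfl, fun j => by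
        obtain ⟨D, hD⟩ := (v j).exists_mem_demand
          (fun x => price 0 x + if x ∈ (∅ : Finset X) then 0 else ε)
        exact ⟨D, hD, Finset.empty_subset D⟩⟩
    obtain ⟨n, hn, h⟩ := Set.exists_max_image _ (fun n : X → ℕ => ∑ x, n x) hfin hne
    exact ⟨n, hn, h⟩
  obtain ⟨h₁, h₂, h₃⟩ := hS
  refine ⟨price n, S, fun x => ?_, h₁, fun x hx => by simp [price, h₂ x hx], fun j => ?_⟩
  · simp only [price]
    have : (0 : ℝ) ≤ n x * ε := by positivity
    linarith
  obtain ⟨D, hD, hSD⟩ := h₃ j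
  by_cases hDS : D ⊆ S j
  · rwa [← hDS.antisymm hSD] at hD ⊢
  exfalso
  -- Bidder `j` seizes `D`. The surcharge on `D \ S j` becomes part of the price, so `j` faces
  -- unchanged prices; for the others, prices stay fixed on what they keep and do not fall
  -- elsewhere.
  let n' : X → ℕ := fun x => n x + if x ∈ D \ S j then 1 else 0
  let S' : ι → Finset X := fun k => if k = j then D else S k \ D
  have hprice : ∀ x, price n' x = price n x + if x ∈ D \ S j then ε else 0 := fun x => by
    simp only [price, n']
    split_ifs <;> push_cast <;> ring
  have hvalid : valid n' S' := by
    refine ⟨fun k l hkl => ?_, fun x hx => ?_, fun k => ?_⟩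
    · simp only [S']
      split_ifs with hk hl hl
      · exact absurd (hk.trans hl.symm) hkl
      · exact Finset.disjoint_sdiff
      · exact Finset.sdiff_disjoint
      · exact (h₁ hkl).mono Finset.sdiff_subset Finset.sdiff_subset
    · have hxD : x ∉ D := by simpa [S'] using hx j
      have hxS : ∀ k, x ∉ S k := fun k hk => by
        have := hx k
        by_cases hkj : k = j
        · subst hkj
          exact hxD (hSD hk)
        · simp [S', hkj, hk, hxD] at this
      simp [n', h₂ x hxS, hxD]
    · by_cases hkj : k = j
      · subst hkj
        have : (fun x => price n' x + if x ∈ S' k then 0 else ε)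
            = fun x => price n x + if x ∈ S k then 0 else ε := by
          ext x
          rw [hprice]
          by_cases hxD : x ∈ D
          · by_cases hxS : x ∈ S k <;> simp [S', hxD, hxS]
          · have hxS : x ∉ S k := fun h => hxD (hSD h)
            simp [S', hxD, hxS]
        rw [this]
        exact ⟨D, hD, by simp [S']⟩
      · obtain ⟨E, hE, hSE⟩ := h₃ k
        have hS'k : S' k = S k \ D := by simp [S', hkj]
        refine (hv k).exists_superset_mem_demand ?_ hE (C := S' k) ?_ ?_
        · intro x
          simp only [hprice, hS'k, Finset.mem_sdiff]
          by_cases hxk : x ∈ S k <;> by_cases hxD : x ∈ D <;> by_cases hxj : x ∈ S j <;>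
            simp only [hxk, hxD, hxj, not_true, not_false_iff, and_true, and_false,
              if_true, if_false] <;> linarith
        · rw [hS'k]
          exact Finset.sdiff_subset.trans hSE
        · intro x hx
          rw [hS'k, Finset.mem_sdiff] at hx
          simp [hprice, hS'k, hx.1, hx.2]
  have hlt : ∑ x, n x < ∑ x, n' x := by
    obtain ⟨x, hxD, hxS⟩ := Finset.not_subset.1 hDS
    exact Finset.sum_lt_sum (fun y _ => Nat.le_add_right _ _)
      ⟨x, Finset.mem_univ x, by simp [n', hxD, hxS]⟩
  exact absurd (hmax n' ⟨S', hvalid⟩) (not_le.2 hlt)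

/-! ### Duality between allocations and prices -/

theorem le_combined [Fintype X] [Fintype ι] (v : ι → Valuation X) {A : ι → Finset X}
    {S : Finset X} (hd : Pairwise fun j k => Disjoint (A j) (A k)) (hA : ∀ j, A j ⊆ S) :
    ∑ j, v j (A j) ≤ combined v S :=
  le_ciSup (f := fun A : Packing ι S => ∑ j, v j (A.1 j)) (Set.finite_range _).bddAbove
    ⟨A, hd, hA⟩

theorem exists_combined_eq [Fintype X] [Fintype ι] (v : ι → Valuation X) (S : Finset X) :
    ∃ A : ι → Finset X, (Pairwise fun j k => Disjoint (A j) (A k)) ∧ (∀ j, A j ⊆ S) ∧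
      combined v S = ∑ j, v j (A j) := by
  obtain ⟨A, hA⟩ := exists_eq_ciSup_of_finite (f := fun A : Packing ι S => ∑ j, v j (A.1 j))
  exact ⟨A.1, A.2.1, A.2.2, hA.symm⟩

/-- Weak duality between allocations and prices. -/
theorem combined_le_indirectUtility [Fintype X] [Fintype ι] (v : ι → Valuation X) {p : X → ℝ}
    (hp : 0 ≤ p) (S : Finset X) :
    combined v S ≤ ∑ j, (v j).indirectUtility p + ∑ x ∈ S, p x := by
  classical
  obtain ⟨A, hd, hA, h⟩ := exists_combined_eq v S
  have h₁ : ∑ j, ∑ x ∈ A j, p x ≤ ∑ x ∈ S, p x := by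
    rw [← Finset.sum_biUnion fun j _ k _ hjk => hd hjk]
    exact Finset.sum_le_sum_of_subset_of_nonneg (Finset.biUnion_subset.2 fun j _ => hA j)
      fun x _ _ => hp x
  have h₂ : ∑ j, (v j (A j) - ∑ x ∈ A j, p x) ≤ ∑ j, (v j).indirectUtility p :=
    Finset.sum_le_sum fun j _ => (v j).surplus_le_indirectUtility p (A j)
  rw [Finset.sum_sub_distrib] at h₂
  linarith

/-- Strong duality between allocations and prices, up to an arbitrarily small error, for gross
substitutes valuations. -/
theorem exists_indirectUtility_le_combined [Fintype X] [Fintype ι]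
    {v : ι → Valuation X} (hv : ∀ j, (v j).GrossSubstitutes) (S : Finset X) {ε : ℝ}
    (hε : 0 < ε) :
    ∃ p : X → ℝ, 0 ≤ p ∧
      ∑ j, (v j).indirectUtility p + ∑ x ∈ S, p x
        ≤ combined v S + Fintype.card ι * (Fintype.card X * ε) := by
  classical
  have hM : 0 ≤ ∑ j, v j Finset.univ := Finset.sum_nonneg fun j _ => (v j).nonneg _
  -- The starting price outside `S` exceeds every bidder's value, so only items of `S` are sold;
  -- inside `S` it is `0`, so unsold items are free.
  obtain ⟨p, A, hrp, hd, hun, hA⟩ := exists_approximate_equilibrium hv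
    (fun x => if x ∈ S then 0 else (∑ j, v j Finset.univ) + 1) hε
  have hp : 0 ≤ p := fun x => le_trans (by
    dsimp only
    split_ifs
    · exact le_rfl
    · exact add_nonneg hM zero_le_one) (hrp x)
  have hAS : ∀ j, A j ⊆ S := fun j x hx => by
    by_contra hxS
    have h₁ := Valuation.price_le_of_mem_demand (hA j) hx
    have h₂ := hrp x
    have h₃ : v j Finset.univ ≤ ∑ j, v j Finset.univ :=
      Finset.single_le_sum (f := fun j => v j Finset.univ)
        (fun j _ => (v j).nonneg _) (Finset.mem_univ j)
    simp only [hx, hxS, if_true, if_false] at h₁ h₂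
    linarith
  have hsum : ∑ j, ∑ x ∈ A j, p x = ∑ x ∈ S, p x := by
    rw [← Finset.sum_biUnion fun j _ k _ hjk => hd hjk]
    refine Finset.sum_subset (Finset.biUnion_subset.2 fun j _ => hAS j) fun x hxS hx => ?_
    have := hun x (by simpa using hx)
    simpa [hxS] using this
  have hj : ∀ j, (v j).indirectUtility p
      ≤ v j (A j) - ∑ x ∈ A j, p x + Fintype.card X * ε := fun j => by
    refine ciSup_le fun T => ?_
    have h := hA j T
    simp only [Valuation.surplus, Finset.sum_add_distrib] at h ⊢
    have h₁ : ∑ x ∈ A j, (if x ∈ A j then 0 else ε) = 0 :=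
      Finset.sum_eq_zero fun x hx => if_pos hx
    have h₂ : ∑ x ∈ T, (if x ∈ A j then 0 else ε) ≤ Fintype.card X * ε := by
      calc ∑ x ∈ T, (if x ∈ A j then 0 else ε) ≤ ∑ _x ∈ T, ε :=
            Finset.sum_le_sum fun x _ => by split_ifs <;> simp [hε.le]
        _ = T.card * ε := by simp
        _ ≤ Fintype.card X * ε := by
            gcongr
            exact Finset.card_le_univ T
    linarith
  refine ⟨p, hp, ?_⟩
  have h := Finset.sum_le_sum fun j (_ : j ∈ Finset.univ) => hj j
  rw [Finset.sum_add_distrib, Finset.sum_sub_distrib, hsum, Finset.sum_const, Finset.card_univ,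
    nsmul_eq_mul] at h
  linarith [le_combined v hd hAS]

/-! ### Submodularity of the combined valuation -/

/-- The combined valuation of gross substitutes valuations is submodular. -/
theorem combined_submodular [Fintype X] [DecidableEq X] [Fintype ι]
    {v : ι → Valuation X} (hv : ∀ j, (v j).GrossSubstitutes) (S T : Finset X) :
    combined v (S ∪ T) + combined v (S ∩ T) ≤ combined v S + combined v T := by
  refine le_of_forall_pos_le_add fun δ hδ => ?_
  set N : ℝ := Fintype.card ι * Fintype.card X with hN
  have hN0 : 0 ≤ N := by positivity
  -- Two uses of strong duality lose `N * ε` each; `N + 1` avoids division by zero.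
  have hε : 0 < δ / (2 * (N + 1)) := by positivity
  have hNε : 2 * (Fintype.card ι * (Fintype.card X * (δ / (2 * (N + 1))))) ≤ δ := by
    rw [← mul_assoc (Fintype.card ι : ℝ), ← hN, ← mul_assoc, ← mul_div_assoc,
      div_le_iff₀ (by positivity)]
    nlinarith
  obtain ⟨p, hp, hpS⟩ := exists_indirectUtility_le_combined hv S hε
  obtain ⟨q, hq, hqT⟩ := exists_indirectUtility_le_combined hv T hε
  have h₁ := combined_le_indirectUtility v (le_inf hp hq) (S ∪ T)
  have h₂ := combined_le_indirectUtility v (hp.trans le_sup_left : 0 ≤ p ⊔ q) (S ∩ T)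
  have h₃ : ∑ j, (v j).indirectUtility (p ⊓ q) + ∑ j, (v j).indirectUtility (p ⊔ q)
      ≤ ∑ j, (v j).indirectUtility p + ∑ j, (v j).indirectUtility q := by
    rw [← Finset.sum_add_distrib, ← Finset.sum_add_distrib]
    exact Finset.sum_le_sum fun j _ => (hv j).indirectUtility_submodular p q
  have h₄ : ∑ x ∈ S ∪ T, (p ⊓ q) x + ∑ x ∈ S ∩ T, (p ⊔ q) x
      ≤ ∑ x ∈ S, p x + ∑ x ∈ T, q x := by
    have hx : ∀ (U : Finset X) (f : X → ℝ), ∑ x ∈ U, f x = ∑ x, if x ∈ U then f x else 0 :=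
      fun U f => by simp
    rw [hx (S ∪ T), hx (S ∩ T), hx S, hx T, ← Finset.sum_add_distrib, ← Finset.sum_add_distrib]
    refine Finset.sum_le_sum fun x _ => ?_
    have := inf_add_sup (p x) (q x)
    by_cases hxS : x ∈ S <;> by_cases hxT : x ∈ T <;> simp [hxS, hxT, this]
  linarith

/-- Marginal values of a union are at most the sum of the marginal values. -/
theorem combined_union_biUnion_le [Fintype X] [DecidableEq X] [Fintype ι]
    {v : ι → Valuation X} (hv : ∀ j, (v j).GrossSubstitutes) {κ : Type*} (R : Finset X)
    (S : κ → Finset X) (s : Finset κ) :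
    combined v (R ∪ s.biUnion S) - combined v R
      ≤ ∑ l ∈ s, (combined v (R ∪ S l) - combined v R) := by
  classical
  induction s using Finset.induction_on with
  | empty => simp
  | insert a s ha ih =>
    rw [Finset.sum_insert ha, Finset.biUnion_insert]
    have h := combined_submodular hv (R ∪ S a) (R ∪ s.biUnion S)
    rw [← Finset.union_union_distrib_left] at h
    have h' := (combined v).mono' R ((R ∪ S a) ∩ (R ∪ s.biUnion S))
      (Finset.subset_inter Finset.subset_union_left Finset.subset_union_left)
    linarith

/-! ### Optimal allocations and VCG payments -/

/-- The value of an optimal allocation is at least the value of giving `S` to `i` and distributing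
the other items optimally among the other bidders. -/
theorem IsOptimalAllocation.add_combined_le [Fintype X] [DecidableEq X] [Fintype ι]
    [DecidableEq ι] {b : ι → Valuation X} {A : ι → Finset X} (hA : IsOptimalAllocation b A)
    (i : ι) (S : Finset X) :
    b i S + combined (fun k : {k : ι // k ≠ i} => b k) (Finset.univ \ S) ≤ ∑ j, b j (A j) := by
  obtain ⟨P, hd, hP, h⟩ := exists_combined_eq (fun k : {k : ι // k ≠ i} => b k) (Finset.univ \ S)
  rw [h]
  let Q : ι → Finset X := fun j =>
    if hj : j ≠ i then P ⟨j, hj⟩ else Finset.univ \ Finset.univ.biUnion P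
  have hQi : Q i = Finset.univ \ Finset.univ.biUnion P := by simp [Q]
  have hQP : ∀ k : {k : ι // k ≠ i}, Q k = P k := fun k => by simp [Q, k.2]
  have hPi : ∀ k : {k : ι // k ≠ i}, Disjoint (Q k) (Q i) := fun k => by
    rw [hQi, hQP]
    exact Finset.disjoint_sdiff.mono_left (Finset.subset_biUnion_of_mem P (Finset.mem_univ k))
  have hQ : IsAllocation Q := by
    refine ⟨fun j k hjk => ?_, fun x => ?_⟩
    · by_cases hj : j = i
      · subst hj
        exact (hPi ⟨k, hjk.symm⟩).symm
      · by_cases hk : k = i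
        · subst hk
          exact hPi ⟨j, hj⟩
        · have := hd (show (⟨j, hj⟩ : {k : ι // k ≠ i}) ≠ ⟨k, hk⟩ by simpa using hjk)
          simpa [Q, hj, hk] using this
    · by_cases hx : ∃ k, x ∈ P k
      · obtain ⟨k, hk⟩ := hx
        exact ⟨k, by rwa [hQP]⟩
      · exact ⟨i, by rw [hQi]; simpa using hx⟩
  have hS : S ⊆ Q i := by
    rw [hQi]
    intro x hx
    simp only [Finset.mem_sdiff, Finset.mem_univ, Finset.mem_biUnion, true_and, not_exists]
    intro k hk
    exact (Finset.mem_sdiff.1 (hP k hk)).2 hx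
  have h₁ := hA.2 Q hQ
  rw [Fintype.sum_eq_add_sum_subtype_ne _ i] at h₁
  simp only [hQP] at h₁
  linarith [(b i).mono' S (Q i) hS]

/-- The sum of the payments of false names is at least the price of their joint bundle. -/
theorem le_payment_falseNameBids [Fintype X] [DecidableEq X] [Fintype ι] [DecidableEq ι]
    (v : ι → Valuation X) (i : ι) {κ : Type*} [Fintype κ] [DecidableEq κ] (w : κ → Valuation X)
    {B : {j : ι // j ≠ i} ⊕ κ → Finset X}
    (hB : IsOptimalAllocation (falseNameBids v i w) B) (l : κ) :
    combined (fun j : {j : ι // j ≠ i} => v j)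
        ((Finset.univ \ Finset.univ.biUnion fun l => B (Sum.inr l)) ∪ B (Sum.inr l))
      - combined (fun j : {j : ι // j ≠ i} => v j)
        (Finset.univ \ Finset.univ.biUnion fun l => B (Sum.inr l))
      ≤ payment (falseNameBids v i w) (Sum.inr l) (B (Sum.inr l)) := by
  set R := Finset.univ \ Finset.univ.biUnion fun l => B (Sum.inr l) with hR
  have hRB : ∀ m, Disjoint R (B (Sum.inr m)) := fun m =>
    Finset.sdiff_disjoint.mono_right
      (Finset.subset_biUnion_of_mem (fun l => B (Sum.inr l)) (Finset.mem_univ m))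
  have hBd : ∀ {a b}, a ≠ b → Disjoint (B a) (B b) := fun h => hB.1.1 h
  -- Optimality of `B` bounds the subtracted term of the payment by what the other bidders get in
  -- `B`.
  have hlower := hB.add_combined_le (Sum.inr l) (B (Sum.inr l))
  have hu : ∑ j : {j : ι // j ≠ i}, v j (B (Sum.inl j))
      ≤ combined (fun j : {j : ι // j ≠ i} => v j) R := by
    refine le_combined (fun j : {j : ι // j ≠ i} => v j)
      (fun j k hjk => hBd (by simpa using hjk)) fun j x hx => ?_
    simp only [hR, Finset.mem_sdiff, Finset.mem_univ, Finset.mem_biUnion, true_and, not_exists]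
    intro m hm
    exact Finset.disjoint_left.1 (hBd (a := Sum.inl j) (b := Sum.inr m) (by simp)) hx hm
  obtain ⟨P, hd, hP, h⟩ := exists_combined_eq (fun j : {j : ι // j ≠ i} => v j)
    (R ∪ B (Sum.inr l))
  -- For the first term of the payment, the other identities keep their bundles and the true players
  -- share `R ∪ B (Sum.inr l)` optimally.
  let Q : {j : ι // j ≠ i} ⊕ κ → Finset X :=
    Sum.elim P fun m => if m = l then ∅ else B (Sum.inr m)
  have hPB : ∀ j m, m ≠ l → Disjoint (P j) (B (Sum.inr m)) := fun j m hm =>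
    (Finset.disjoint_union_left.2 ⟨hRB m, hBd (by simpa using hm.symm)⟩).mono_left (hP j)
  have hQ : Pairwise fun a b => Disjoint (Q a) (Q b) := by
    rintro (j | m) (k | m') hne
    · exact hd (by simpa using hne)
    · by_cases hm : m' = l
      · simp [Q, hm]
      · simpa [Q, hm] using hPB j m' hm
    · by_cases hm : m = l
      · simp [Q, hm]
      · simpa [Q, hm] using (hPB k m hm).symm
    · by_cases hm : m = l
      · simp [Q, hm]
      · by_cases hm' : m' = l
        · simp [Q, hm']
        · simpa [Q, hm, hm'] using hBd hne
  have hupper := le_combined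
    (fun a : {a : {j : ι // j ≠ i} ⊕ κ // a ≠ Sum.inr l} => falseNameBids v i w a)
    (A := fun a => Q a) (S := Finset.univ)
    (fun a b hab => hQ (fun h => hab (Subtype.ext h))) fun a => Finset.subset_univ _
  have hsum := Fintype.sum_eq_add_sum_subtype_ne
    (fun a => falseNameBids v i w a (Q a)) (Sum.inr l)
  have hw₁ := Fintype.sum_eq_add_sum_subtype_ne (fun m => w m (B (Sum.inr m))) l
  have hw₂ := Fintype.sum_eq_add_sum_subtype_ne
    (fun m => w m (if m = l then ∅ else B (Sum.inr m))) l
  have hw₃ : ∑ m : {m // m ≠ l}, w m (if (m : κ) = l then ∅ else B (Sum.inr (m : κ)))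
      = ∑ m : {m // m ≠ l}, w m (B (Sum.inr (m : κ))) :=
    Finset.sum_congr rfl fun m _ => by rw [if_neg m.2]
  rw [Fintype.sum_sum_type] at hsum hlower
  simp only [falseNameBids, Sum.elim_inl, Sum.elim_inr, Q, if_true,
    (w l).map_empty'] at hsum hlower hupper hw₂
  simp only [payment, falseNameBids]
  linarith

end Helpers

end VCG

theorem mainTheorem9 {X ι : Type*} [Fintype X] [DecidableEq X] [Fintype ι] [DecidableEq ι]
    (v : ι → VCG.Valuation X) (hv : ∀ j, (v j).GrossSubstitutes) (i : ι)
    (k : ℕ) (w : Fin k → VCG.Valuation X)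
    (A : ι → Finset X) (hA : VCG.IsOptimalAllocation v A)
    (B : {j : ι // j ≠ i} ⊕ Fin k → Finset X)
    (hB : VCG.IsOptimalAllocation (VCG.falseNameBids v i w) B) :
    v i (Finset.univ.biUnion fun l : Fin k => B (Sum.inr l))
        - ∑ l : Fin k, VCG.payment (VCG.falseNameBids v i w) (Sum.inr l) (B (Sum.inr l))
      ≤ v i (A i) - VCG.payment v i (A i) := by
  have h₁ := Finset.sum_le_sum fun l (_ : l ∈ Finset.univ) =>
    VCG.le_payment_falseNameBids v i w hB l
  have h₂ := VCG.combined_union_biUnion_le (fun j : {j : ι // j ≠ i} => hv j)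
    (Finset.univ \ Finset.univ.biUnion fun l => B (Sum.inr l)) (fun l => B (Sum.inr l))
    Finset.univ
  rw [Finset.sdiff_union_of_subset (Finset.subset_univ _)] at h₂
  have h₃ := hA.add_combined_le i (Finset.univ.biUnion fun l => B (Sum.inr l))
  have h₄ := VCG.le_combined (fun j : {j : ι // j ≠ i} => v j) (A := fun j => A j)
    (S := Finset.univ \ A i) (fun j k hjk => hA.1.1 fun h => hjk (Subtype.ext h))
    fun j => Finset.subset_sdiff.2 ⟨Finset.subset_univ _, hA.1.1 j.2⟩
  rw [Fintype.sum_eq_add_sum_subtype_ne _ i] at h₃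
  simp only [VCG.payment] at h₁ ⊢
  linarith
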